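/- **Setting.** Let $(M^m,g_M)$ and $(N^n,g_N)$ be smooth Riemannian manifolds and let $F:M\to N$ be a Riemannian map, i.e. a smooth map such that $g_N(F_*u,F_*v)=g_M(u,v)$ for all $p\in M$ and $u,v\in(\ker F_{*p})^\perp$. Let ${}^*F_{*p}:T_{F(p)}N\to T_pM$ be the adjoint of $F_{*p}$, let $\nabla^N$ be the Levi-Civita connection of $N$ and $R^N(A,B)C=\nabla^N_A\nabla^N_BC-\nabla^N_B\nabla^N_AC-\nabla^N_{[A,B]}C$. Let $U\subseteq M$ and $O\subseteq N$ be open with $F(U)\subseteq O$, and suppose that $\operatorname{range}F_*$ is given as a smooth distribution on $O$: a smooth distribution $\mathcal D$ on $O$ with $\mathcal D_{F(q)}=F_{*q}(T_qM)$ for all $q\in U$. Write $(\operatorname{range}F_*)^\perp=\mathcal D^\perp$. Assume that $\mathcal D^\perp$ is totally geodesic on $O$, i.e. $\nabla^N_ZV\in\Gamma(\mathcal D^\perp)$ for all $Z,V\in\Gamma(\mathcal D^\perp)$. For $V\in\Gamma(\mathcal D^\perp)$ and a tangent vector $a$ of $N$ at a point of $O$, decompose $$\nabla^N_aV=-\mathcal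 S_Va+\nabla^{F\perp}_aV,\qquad \mathcal S_Va\in\mathcal D,\quad \nabla^{F\perp}_aV\in\mathcal D^\perp,$$ and for $u\in T_qM$, $q\in U$, put $\nabla^{F\perp}_uV=\nabla^{F\perp}_{F_*u}V$. Let $R^{F\perp}$ be the curvature of $\nabla^{F\perp}$: $$R^{F\perp}(A,B)W=\nabla^{F\perp}_A\nabla^{F\perp}_BW-\nabla^{F\perp}_B\nabla^{F\perp}_AW-\nabla^{F\perp}_{[A,B]}W.$$ **Statement.** Let $X$ be a vector field on $M$, let $V,W\in\Gamma(\mathcal D^\perp)$ be smooth sections over $O$, let $p\in U$, and let $A\in\Gamma(\mathcal D)$ be a smooth section over $O$ with $A_{F(p)}=F_{*p}X_p$; where $F_*X$ is differentiated, or $\nabla^{F\perp}_XW$, $\mathcal S_WF_*X$ are used as vector fields on $N$, $F_*X$ stands for $A$ (so $\nabla_X^{F\perp}W=\nabla_A^{F\perp}W$ there). Then at the point $F(p)$ $$\begin{aligned}R^N(F_*X,V)W=&-\mathcal S_{\nabla_V^{F\perp}W}F_*X+\nabla_X^{F\perp}\nabla_V^{F\perp}W+\nabla_V^N\mathcal S_WF_*X-\nabla_V^{F\perp}\nabla_X^{F\perp}W-\mathcal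 S_W\mathcal S_VF_*X\\&+\nabla^{F\perp}_{{}^*F_*(\mathcal S_VF_*X)}W-\nabla^{F\perp}_{\nabla_X^{F\perp}V}W-\mathcal S_W\nabla_V^NF_*X+\nabla^{F\perp}_{{}^*F_*(\nabla_V^NF_*X)}W,\end{aligned}$$ and the component of $R^N(F_*X,V)W$ in $(\operatorname{range}F_*)^\perp$ is $$R^{F\perp}(F_*X,V)W=\nabla_X^{F\perp}\nabla_V^{F\perp}W-\nabla_V^{F\perp}\nabla_X^{F\perp}W-\nabla^{F\perp}_{\nabla_X^{F\perp}V}W+\nabla^{F\perp}_{{}^*F_*(\mathcal S_VF_*X)}W+\nabla^{F\perp}_{{}^*F_*(\nabla_V^NF_*X)}W.$$ -/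

import Mathlib

open Bundle Manifold VectorField
open scoped ContDiff Topology

noncomputable section

namespace RiemannianGeometry

section LeviCivita

variable {E : Type*} [NormedAddCommGroup E] [NormedSpace ℝ E] [FiniteDimensional ℝ E]
  {H : Type*} [TopologicalSpace H] (I : ModelWithCorners ℝ E H)
  {M : Type*} [TopologicalSpace M] [ChartedSpace H M] [IsManifold I ∞ M]
  [RiemannianBundle (fun x : M ↦ TangentSpace I x)]
  [IsContMDiffRiemannianBundle I ∞ E (fun x : M ↦ TangentSpace I x)]

instance finiteDimensional_tangentSpace (x : M) : FiniteDimensional ℝ (TangentSpace I x) :=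
  inferInstanceAs (FiniteDimensional ℝ E)

/-- The Koszul expression: `koszul I Y X Z x` is the right-hand side of the Koszul formula for
`g(∇_X Y, Z)` at the point `x`. -/
def koszul (Y X Z : Π x : M, TangentSpace I x) (x : M) : ℝ :=
  (1 / 2 : ℝ) *
    (d% (fun y : M ↦ inner ℝ (Y y) (Z y)) x (X x)
      + d% (fun y : M ↦ inner ℝ (X y) (Z y)) x (Y x)
      - d% (fun y : M ↦ inner ℝ (X y) (Y y)) x (Z x)
      + inner ℝ (mlieBracket I X Y x) (Z x)
      - inner ℝ (mlieBracket I X Z x) (Y x)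
      - inner ℝ (mlieBracket I Y Z x) (X x))

variable {I}

set_option linter.unusedSectionVars false in
theorem mdifferentiableAt_inner {Y Z : Π x : M, TangentSpace I x} {x : M}
    (hY : MDiffAt (T% Y) x) (hZ : MDiffAt (T% Z) x) :
    MDiffAt (fun y : M ↦ inner ℝ (Y y) (Z y)) x :=
  MDifferentiableAt.inner_bundle (IB := I) (F := E) (E := fun x : M ↦ TangentSpace I x)
    (b := fun y ↦ y) hY hZ

theorem koszul_tensorial_right {Y X : Π x : M, TangentSpace I x} {x : M}
    (hY : MDiffAt (T% Y) x) (hX : MDiffAt (T% X) x) :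
    TensorialAt I E (fun Z ↦ koszul I Y X Z x) x where
  smul {f Z} hf hZ := by
    have h1 : d% (fun y : M ↦ inner ℝ (Y y) ((f • Z) y)) x (X x)
        = f x * d% (fun y : M ↦ inner ℝ (Y y) (Z y)) x (X x)
          + d% f x (X x) * inner ℝ (Y x) (Z x) := by
      have : (fun y : M ↦ inner ℝ (Y y) ((f • Z) y)) = f * (fun y : M ↦ inner ℝ (Y y) (Z y)) := by
        ext y; simp [inner_smul_right]
      rw [this, mvfderiv_mul hf (mdifferentiableAt_inner hY hZ)]
      simp; ring
    have h2 : d% (fun y : M ↦ inner ℝ (X y) ((f • Z) y)) x (Y x)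
        = f x * d% (fun y : M ↦ inner ℝ (X y) (Z y)) x (Y x)
          + d% f x (Y x) * inner ℝ (X x) (Z x) := by
      have : (fun y : M ↦ inner ℝ (X y) ((f • Z) y)) = f * (fun y : M ↦ inner ℝ (X y) (Z y)) := by
        ext y; simp [inner_smul_right]
      rw [this, mvfderiv_mul hf (mdifferentiableAt_inner hX hZ)]
      simp; ring
    simp only [koszul]
    rw [h1, h2]
    simp only [mlieBracket_smul_right hf hZ, inner_add_left, inner_smul_left,
      Pi.smul_apply', inner_smul_right, map_smul, smul_eq_mul, RCLike.conj_to_real]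
    rw [real_inner_comm (Z x) (Y x), real_inner_comm (Z x) (X x)]
    ring
  add {Z Z'} hZ hZ' := by
    have h1 : d% (fun y : M ↦ inner ℝ (Y y) ((Z + Z') y)) x
        = d% (fun y : M ↦ inner ℝ (Y y) (Z y)) x + d% (fun y : M ↦ inner ℝ (Y y) (Z' y)) x := by
      rw [← mvfderiv_add (mdifferentiableAt_inner hY hZ) (mdifferentiableAt_inner hY hZ')]
      congr 1; ext y; simp [inner_add_right]
    have h2 : d% (fun y : M ↦ inner ℝ (X y) ((Z + Z') y)) x
        = d% (fun y : M ↦ inner ℝ (X y) (Z y)) x + d% (fun y : M ↦ inner ℝ (X y) (Z' y)) x := by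
      rw [← mvfderiv_add (mdifferentiableAt_inner hX hZ) (mdifferentiableAt_inner hX hZ')]
      congr 1; ext y; simp [inner_add_right]
    simp only [koszul]
    rw [h1, h2]
    simp only [mlieBracket_add_right hZ hZ', inner_add_left,
      Pi.add_apply, inner_add_right, map_add, _root_.add_apply]
    ring

theorem koszul_tensorial_left {Y Z : Π x : M, TangentSpace I x} {x : M}
    (hY : MDiffAt (T% Y) x) (hZ : MDiffAt (T% Z) x) :
    TensorialAt I E (fun X ↦ koszul I Y X Z x) x where
  smul {f X} hf hX := by
    have h1 : d% (fun y : M ↦ inner ℝ ((f • X) y) (Y y)) x (Z x)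
        = f x * d% (fun y : M ↦ inner ℝ (X y) (Y y)) x (Z x)
          + d% f x (Z x) * inner ℝ (X x) (Y x) := by
      have : (fun y : M ↦ inner ℝ ((f • X) y) (Y y)) = f * (fun y : M ↦ inner ℝ (X y) (Y y)) := by
        ext y; simp [inner_smul_left]
      rw [this, mvfderiv_mul hf (mdifferentiableAt_inner hX hY)]
      simp; ring
    have h2 : d% (fun y : M ↦ inner ℝ ((f • X) y) (Z y)) x (Y x)
        = f x * d% (fun y : M ↦ inner ℝ (X y) (Z y)) x (Y x)
          + d% f x (Y x) * inner ℝ (X x) (Z x) := by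
      have : (fun y : M ↦ inner ℝ ((f • X) y) (Z y)) = f * (fun y : M ↦ inner ℝ (X y) (Z y)) := by
        ext y; simp [inner_smul_left]
      rw [this, mvfderiv_mul hf (mdifferentiableAt_inner hX hZ)]
      simp; ring
    simp only [koszul]
    rw [h1, h2]
    simp only [mlieBracket_smul_left hf hX, inner_add_left, inner_smul_left,
      Pi.smul_apply', inner_smul_right, map_smul, smul_eq_mul, RCLike.conj_to_real, neg_smul,
      inner_neg_left]
    ring
  add {X X'} hX hX' := by
    have h1 : d% (fun y : M ↦ inner ℝ ((X + X') y) (Y y)) x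
        = d% (fun y : M ↦ inner ℝ (X y) (Y y)) x + d% (fun y : M ↦ inner ℝ (X' y) (Y y)) x := by
      rw [← mvfderiv_add (mdifferentiableAt_inner hX hY) (mdifferentiableAt_inner hX' hY)]
      congr 1; ext y; simp [inner_add_left]
    have h2 : d% (fun y : M ↦ inner ℝ ((X + X') y) (Z y)) x
        = d% (fun y : M ↦ inner ℝ (X y) (Z y)) x + d% (fun y : M ↦ inner ℝ (X' y) (Z y)) x := by
      rw [← mvfderiv_add (mdifferentiableAt_inner hX hZ) (mdifferentiableAt_inner hX' hZ)]
      congr 1; ext y; simp [inner_add_left]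
    simp only [koszul]
    rw [h1, h2]
    simp only [mlieBracket_add_left hX hX', inner_add_left,
      Pi.add_apply, inner_add_right, map_add, _root_.add_apply]
    ring

theorem koszul_add {Y Y' X Z : Π x : M, TangentSpace I x} {x : M}
    (hY : MDiffAt (T% Y) x) (hY' : MDiffAt (T% Y') x) (hX : MDiffAt (T% X) x)
    (hZ : MDiffAt (T% Z) x) :
    koszul I (Y + Y') X Z x = koszul I Y X Z x + koszul I Y' X Z x := by
  have h1 : d% (fun y : M ↦ inner ℝ ((Y + Y') y) (Z y)) x
      = d% (fun y : M ↦ inner ℝ (Y y) (Z y)) x + d% (fun y : M ↦ inner ℝ (Y' y) (Z y)) x := by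
    rw [← mvfderiv_add (mdifferentiableAt_inner hY hZ) (mdifferentiableAt_inner hY' hZ)]
    congr 1; ext y; simp [inner_add_left]
  have h2 : d% (fun y : M ↦ inner ℝ (X y) ((Y + Y') y)) x
      = d% (fun y : M ↦ inner ℝ (X y) (Y y)) x + d% (fun y : M ↦ inner ℝ (X y) (Y' y)) x := by
    rw [← mvfderiv_add (mdifferentiableAt_inner hX hY) (mdifferentiableAt_inner hX hY')]
    congr 1; ext y; simp [inner_add_right]
  simp only [koszul]
  rw [h1, h2]
  simp only [mlieBracket_add_left hY hY', mlieBracket_add_right hY hY',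
    inner_add_left, Pi.add_apply, inner_add_right, map_add, _root_.add_apply]
  ring

theorem koszul_leibniz {f : M → ℝ} {Y X Z : Π x : M, TangentSpace I x} {x : M}
    (hf : MDiffAt f x) (hY : MDiffAt (T% Y) x) (hX : MDiffAt (T% X) x)
    (hZ : MDiffAt (T% Z) x) :
    koszul I (f • Y) X Z x
      = f x * koszul I Y X Z x + d% f x (X x) * inner ℝ (Y x) (Z x) := by
  have h1 : d% (fun y : M ↦ inner ℝ ((f • Y) y) (Z y)) x (X x)
      = f x * d% (fun y : M ↦ inner ℝ (Y y) (Z y)) x (X x)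
        + d% f x (X x) * inner ℝ (Y x) (Z x) := by
    have : (fun y : M ↦ inner ℝ ((f • Y) y) (Z y)) = f * (fun y : M ↦ inner ℝ (Y y) (Z y)) := by
      ext y; simp [inner_smul_left]
    rw [this, mvfderiv_mul hf (mdifferentiableAt_inner hY hZ)]
    simp; ring
  have h2 : d% (fun y : M ↦ inner ℝ (X y) ((f • Y) y)) x (Z x)
      = f x * d% (fun y : M ↦ inner ℝ (X y) (Y y)) x (Z x)
        + d% f x (Z x) * inner ℝ (X x) (Y x) := by
    have : (fun y : M ↦ inner ℝ (X y) ((f • Y) y)) = f * (fun y : M ↦ inner ℝ (X y) (Y y)) := by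
      ext y; simp [inner_smul_right]
    rw [this, mvfderiv_mul hf (mdifferentiableAt_inner hX hY)]
    simp; ring
  simp only [koszul]
  rw [h1, h2]
  simp only [mlieBracket_smul_left hf hY, mlieBracket_smul_right hf hY,
    inner_add_left, inner_smul_left, Pi.smul_apply', inner_smul_right, map_smul, smul_eq_mul,
    RCLike.conj_to_real, neg_smul, inner_neg_left]
  rw [real_inner_comm (X x) (Y x)]
  ring

open Classical in
/-- The Levi-Civita connection as a function: at a point where `Y` is differentiable,
`leviCivitaFun Y x v` is the vector `∇_v Y` determined by the Koszul formula. (At points where `Y`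
is not differentiable the value is `0` by convention.) -/
def leviCivitaFun (Y : Π x : M, TangentSpace I x) (x : M) : TangentSpace I x →L[ℝ] TangentSpace I x :=
  haveI : CompleteSpace (TangentSpace I x) := FiniteDimensional.complete ℝ _
  if hY : MDiffAt (T% Y) x then
    ((InnerProductSpace.toDual ℝ (TangentSpace I x)).symm.toContinuousLinearEquiv :
        StrongDual ℝ (TangentSpace I x) →L⋆[ℝ] TangentSpace I x).comp <|
      TensorialAt.mkHom₂ (fun X Z ↦ koszul I Y X Z x) x
        (fun _ hZ ↦ koszul_tensorial_left hY hZ) (fun _ hX ↦ koszul_tensorial_right hY hX)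
  else 0

/-- **Koszul formula** -/
theorem inner_leviCivitaFun {Y X Z : Π x : M, TangentSpace I x} {x : M}
    (hY : MDiffAt (T% Y) x) (hX : MDiffAt (T% X) x) (hZ : MDiffAt (T% Z) x) :
    inner ℝ (leviCivitaFun Y x (X x)) (Z x) = koszul I Y X Z x := by
  have : CompleteSpace (TangentSpace I x) := FiniteDimensional.complete ℝ _
  rw [leviCivitaFun, dif_pos hY]
  have := TensorialAt.mkHom₂_apply (I := I) (Φ := fun X Z ↦ koszul I Y X Z x) (x := x)
    (fun _ hZ ↦ koszul_tensorial_left hY hZ) (fun _ hX ↦ koszul_tensorial_right hY hX) hX hZ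
  rw [← this]
  exact InnerProductSpace.toDual_symm_apply

theorem leviCivitaFun_eq {Y : Π x : M, TangentSpace I x} {x : M} (hY : MDiffAt (T% Y) x)
    (v w : TangentSpace I x) :
    inner ℝ (leviCivitaFun Y x v) w
      = koszul I Y (FiberBundle.extend E v) (FiberBundle.extend E w) x := by
  have := inner_leviCivitaFun hY (FiberBundle.mdifferentiableAt_extend I E v)
    (FiberBundle.mdifferentiableAt_extend I E w)
  simpa using this

variable (I M) in
/-- The **Levi-Civita connection** of a Riemannian manifold, defined by the Koszul formula.
`leviCivita I M Y x v` is `∇_v Y` at the point `x`. -/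
def leviCivita : CovariantDerivative I E (fun x : M ↦ TangentSpace I x) where
  toFun := leviCivitaFun
  isCovariantDerivativeOnUniv :=
    { add := by
        intro Y Y' x hY hY' _
        ext1 v
        refine ext_inner_right ℝ fun w ↦ ?_
        have hv := FiberBundle.mdifferentiableAt_extend I E v
        have hw := FiberBundle.mdifferentiableAt_extend I E w
        rw [_root_.add_apply, inner_add_left, leviCivitaFun_eq (mdifferentiableAt_add_section hY hY'),
          leviCivitaFun_eq hY, leviCivitaFun_eq hY', koszul_add hY hY' hv hw]
      leibniz := by
        intro Y f x hY hf _
        ext1 v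
        refine ext_inner_right ℝ fun w ↦ ?_
        have hv := FiberBundle.mdifferentiableAt_extend I E v
        have hw := FiberBundle.mdifferentiableAt_extend I E w
        have h := koszul_leibniz hf hY hv hw
        rw [leviCivitaFun_eq (hf.smul_section hY), h]
        simp [inner_add_left, inner_smul_left, leviCivitaFun_eq hY] }

/-- The Levi-Civita connection is torsion-free. -/
theorem leviCivita_torsion_free {X Y : Π x : M, TangentSpace I x} {x : M}
    (hX : MDiffAt (T% X) x) (hY : MDiffAt (T% Y) x) :
    leviCivita I M Y x (X x) - leviCivita I M X x (Y x) = mlieBracket I X Y x := by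
  refine ext_inner_right ℝ fun w ↦ ?_
  have hw := FiberBundle.mdifferentiableAt_extend I E w
  have h1 := inner_leviCivitaFun hY hX hw
  have h2 := inner_leviCivitaFun hX hY hw
  rw [FiberBundle.extend_apply_self] at h1 h2
  rw [inner_sub_left]
  change inner ℝ (leviCivitaFun Y x (X x)) w - inner ℝ (leviCivitaFun X x (Y x)) w = _
  have h3 : (fun y : M ↦ inner ℝ (Y y) (X y)) = fun y : M ↦ inner ℝ (X y) (Y y) := by
    ext y; exact real_inner_comm _ _
  rw [h1, h2]
  simp only [koszul, h3, mlieBracket_swap_apply (V := Y) (W := X), inner_neg_left,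
    FiberBundle.extend_apply_self]
  ring

/-- The Levi-Civita connection is compatible with the metric. -/
theorem leviCivita_metric {X Y Z : Π x : M, TangentSpace I x} {x : M}
    (hX : MDiffAt (T% X) x) (hY : MDiffAt (T% Y) x) (hZ : MDiffAt (T% Z) x) :
    d% (fun y : M ↦ inner ℝ (Y y) (Z y)) x (X x)
      = inner ℝ (leviCivita I M Y x (X x)) (Z x) + inner ℝ (Y x) (leviCivita I M Z x (X x)) := by
  have h1 := inner_leviCivitaFun hY hX hZ
  have h2 := inner_leviCivitaFun hZ hX hY
  rw [real_inner_comm (leviCivita I M Z x (X x)) (Y x)]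
  change _ = inner ℝ (leviCivitaFun Y x (X x)) (Z x) + inner ℝ (leviCivitaFun Z x (X x)) (Y x)
  have h3 : (fun y : M ↦ inner ℝ (Z y) (Y y)) = fun y : M ↦ inner ℝ (Y y) (Z y) := by
    ext y; exact real_inner_comm _ _
  rw [h1, h2]
  simp only [koszul, h3, mlieBracket_swap_apply (V := Z) (W := Y), inner_neg_left]
  ring

/-- The Riemann curvature `R(X,Y)Z = ∇_X ∇_Y Z - ∇_Y ∇_X Z - ∇_{[X,Y]} Z`. -/
def riemannCurvature (X Y Z : Π x : M, TangentSpace I x) (x : M) : TangentSpace I x :=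
  leviCivita I M (fun y ↦ leviCivita I M Z y (Y y)) x (X x)
    - leviCivita I M (fun y ↦ leviCivita I M Z y (X y)) x (Y x)
    - leviCivita I M Z x (mlieBracket I X Y x)

end LeviCivita

section Distribution

variable {E : Type*} [NormedAddCommGroup E] [NormedSpace ℝ E] [FiniteDimensional ℝ E]
  {H : Type*} [TopologicalSpace H] {I : ModelWithCorners ℝ E H}
  {N : Type*} [TopologicalSpace N] [ChartedSpace H N] [IsManifold I ∞ N]

/-- `D` is a smooth distribution (smooth vector subbundle of the tangent bundle, of locally constant
rank) over the set `O`: near each point of `O` it has a smooth frame. -/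
def IsSmoothDistributionOn (D : Π y : N, Submodule ℝ (TangentSpace I y)) (O : Set N) : Prop :=
  ∀ y ∈ O, ∃ O' ∈ 𝓝 y, ∃ (k : ℕ) (s : Fin k → Π z : N, TangentSpace I z),
    (∀ i, ContMDiffOn I I.tangent ∞ (fun z ↦ (⟨z, s i z⟩ : TangentBundle I N)) O') ∧
    ∀ z ∈ O', LinearIndependent ℝ (fun i ↦ s i z) ∧
      Submodule.span ℝ (Set.range fun i ↦ s i z) = D z

/-- `V` restricts to a smooth section over `O` of the distribution `D`. -/
def IsSmoothSectionOn (D : Π y : N, Submodule ℝ (TangentSpace I y)) (O : Set N)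
    (V : Π y : N, TangentSpace I y) : Prop :=
  ContMDiffOn I I.tangent ∞ (fun y ↦ (⟨y, V y⟩ : TangentBundle I N)) O ∧ ∀ y ∈ O, V y ∈ D y

variable [RiemannianBundle (fun y : N ↦ TangentSpace I y)]
  [IsContMDiffRiemannianBundle I ∞ E (fun y : N ↦ TangentSpace I y)]

/-- The orthogonal complement `D^⊥` of a distribution. -/
def orthDistribution (D : Π y : N, Submodule ℝ (TangentSpace I y)) (y : N) :
    Submodule ℝ (TangentSpace I y) := (D y)ᗮ

/-- The distribution `D` is totally geodesic over `O`: `∇_U V` is a section of `D` whenever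
`U` and `V` are. -/
def IsTotallyGeodesicOn (D : Π y : N, Submodule ℝ (TangentSpace I y)) (O : Set N) : Prop :=
  ∀ U V : Π y : N, TangentSpace I y, IsSmoothSectionOn D O U → IsSmoothSectionOn D O V →
    ∀ y ∈ O, leviCivita I N V y (U y) ∈ D y

/-- `shape D V y a` is `S_V a`, where `- S_V a` is the component of `∇_a V` in `D`. -/
def shape (D : Π y : N, Submodule ℝ (TangentSpace I y)) (V : Π y : N, TangentSpace I y) (y : N) :
    TangentSpace I y →L[ℝ] TangentSpace I y :=
  -((D y).starProjection ∘L leviCivita I N V y)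

/-- The vector field `S_V A`, for vector fields `V` and `A`. -/
def shapeField (D : Π y : N, Submodule ℝ (TangentSpace I y)) (V A : Π y : N, TangentSpace I y)
    (y : N) : TangentSpace I y :=
  shape D V y (A y)

/-- `normalConn D V y a` is `∇^⊥_a V`, the component of `∇_a V` in `D^⊥`. -/
def normalConn (D : Π y : N, Submodule ℝ (TangentSpace I y)) (V : Π y : N, TangentSpace I y)
    (y : N) : TangentSpace I y →L[ℝ] TangentSpace I y :=
  (orthDistribution D y).starProjection ∘L leviCivita I N V y

/-- The vector field `∇^⊥_A V`, for vector fields `A` and `V`. -/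
def normalConnField (D : Π y : N, Submodule ℝ (TangentSpace I y)) (A V : Π y : N, TangentSpace I y)
    (y : N) : TangentSpace I y :=
  normalConn D V y (A y)

/-- The curvature `R^⊥(A,B)V = ∇^⊥_A ∇^⊥_B V - ∇^⊥_B ∇^⊥_A V - ∇^⊥_{[A,B]} V` of `∇^⊥`. -/
def normalCurvature (D : Π y : N, Submodule ℝ (TangentSpace I y))
    (A B V : Π y : N, TangentSpace I y) (y : N) : TangentSpace I y :=
  normalConn D (normalConnField D B V) y (A y) - normalConn D (normalConnField D A V) y (B y)
    - normalConn D V y (mlieBracket I A B y)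

end Distribution

section Map

variable {E : Type*} [NormedAddCommGroup E] [NormedSpace ℝ E] [FiniteDimensional ℝ E]
  {H : Type*} [TopologicalSpace H] (I : ModelWithCorners ℝ E H)
  {M : Type*} [TopologicalSpace M] [ChartedSpace H M] [IsManifold I ∞ M]
  [RiemannianBundle (fun x : M ↦ TangentSpace I x)]
  [IsContMDiffRiemannianBundle I ∞ E (fun x : M ↦ TangentSpace I x)]
  {E' : Type*} [NormedAddCommGroup E'] [NormedSpace ℝ E'] [FiniteDimensional ℝ E']
  {H' : Type*} [TopologicalSpace H'] (J : ModelWithCorners ℝ E' H')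
  {N : Type*} [TopologicalSpace N] [ChartedSpace H' N] [IsManifold J ∞ N]
  [RiemannianBundle (fun y : N ↦ TangentSpace J y)]
  [IsContMDiffRiemannianBundle J ∞ E' (fun y : N ↦ TangentSpace J y)]

/-- `F` is a Riemannian map: it is smooth and its differential is isometric on the orthogonal
complement of its kernel, at each point. -/
def IsRiemannianMap (F : M → N) : Prop :=
  ContMDiff I J ∞ F ∧ ∀ (p : M), ∀ u ∈ (mfderiv I J F p).kerᗮ, ∀ v ∈ (mfderiv I J F p).kerᗮ,
    inner ℝ (mfderiv I J F p u) (mfderiv I J F p v) = inner ℝ u v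

/-- The adjoint `*F_*` of the differential of `F` at `p`. -/
def adjointDifferential (F : M → N) (p : M) : TangentSpace J (F p) →ₗ[ℝ] TangentSpace I p :=
  LinearMap.adjoint (mfderiv I J F p).toLinearMap

variable {J} in
/-- `∇^{F⊥}_u V` for a tangent vector `u` of `M` at `p`: the component in `D^⊥` of the pullback
connection applied to `V ∘ F`, that is, of `∇_{F_* u} V` at `F p`. -/
def normalConnAlong (F : M → N) (D : Π y : N, Submodule ℝ (TangentSpace J y))
    (V : Π y : N, TangentSpace J y) (p : M) : TangentSpace I p →L[ℝ] TangentSpace J (F p) :=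
  normalConn D V (F p) ∘L mfderiv I J F p

end Map

end RiemannianGeometry

end

open RiemannianGeometry

namespace RiemannianGeometry

section SmoothSections

variable {E : Type*} [NormedAddCommGroup E] [NormedSpace ℝ E]
  {H : Type*} [TopologicalSpace H] {I : ModelWithCorners ℝ E H}
  {M : Type*} [TopologicalSpace M] [ChartedSpace H M] [IsManifold I ∞ M]

theorem contMDiffAt_mvfderiv_apply {f : M → ℝ} {X : Π x : M, TangentSpace I x} {x : M}
    (hf : CMDiffAt ∞ f x) (hX : CMDiffAt ∞ (T% X) x) :
    CMDiffAt ∞ (fun y ↦ d% f y (X y)) x := by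
  have hϕ := hf.mfderiv_const (m := ∞) (by simp)
  have h := ContMDiffAt.clm_apply_of_inCoordinates (b₁ := id) (b₂ := f)
    (v := X) (ϕ := fun y ↦ mfderiv I 𝓘(ℝ, ℝ) f y) hϕ hX hf
  rw [contMDiffAt_totalSpace] at h
  simpa [mvfderiv] using! h.2

theorem contMDiffAt_mlieBracket [CompleteSpace E] {X Y : Π y : M, TangentSpace I y} {x : M}
    (hX : CMDiffAt ∞ (T% X) x) (hY : CMDiffAt ∞ (T% Y) x) :
    CMDiffAt ∞ (T% (mlieBracket I X Y)) x :=
  have : IsManifold I (minSmoothness ℝ 2) M := by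
    rw [minSmoothness_of_isRCLikeNormedField]; infer_instance
  have : IsManifold I ((⊤ : ℕ∞) + 1 : ℕ∞ω) M := by simpa using! ‹IsManifold I ∞ M›
  ContMDiffAt.mlieBracket_vectorField (m := ⊤) (n := ⊤) hX hY (by simp)

theorem eventually_mdifferentiableAt {X : Π y : M, TangentSpace I y} {x : M}
    (hX : CMDiffAt ∞ (T% X) x) : ∀ᶠ y in 𝓝 x, MDiffAt (T% X) y := by
  have h1 : CMDiffAt 1 (T% X) x := hX.of_le (by simp)
  filter_upwards [(contMDiffAt_iff_contMDiffAt_nhds (by simp)).mp h1] with y hy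
  exact hy.mdifferentiableAt one_ne_zero

variable [RiemannianBundle (fun x : M ↦ TangentSpace I x)]
  [IsContMDiffRiemannianBundle I ∞ E (fun x : M ↦ TangentSpace I x)]

theorem contMDiffAt_inner {Y Z : Π x : M, TangentSpace I x} {x : M}
    (hY : CMDiffAt ∞ (T% Y) x) (hZ : CMDiffAt ∞ (T% Z) x) :
    CMDiffAt ∞ (fun y : M ↦ inner ℝ (Y y) (Z y)) x :=
  ContMDiffAt.inner_bundle (IB := I) (F := E) (E := fun x : M ↦ TangentSpace I x)
    (b := fun y ↦ y) hY hZ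

theorem contMDiffAt_div_inner_self_smul {Z : Π x : M, TangentSpace I x} {x : M}
    (hZ : CMDiffAt ∞ (T% Z) x) {f : M → ℝ} (hf : CMDiffAt ∞ f x) (h0 : Z x ≠ 0) :
    CMDiffAt ∞ (T% (fun y ↦ (f y / inner ℝ (Z y) (Z y)) • Z y)) x :=
  (hf.div₀ (contMDiffAt_inner hZ hZ) (by simpa using h0)).smul_section hZ

theorem contMDiffAt_gramSchmidt {k : ℕ} {s : Fin k → Π x : M, TangentSpace I x} {x : M}
    (hs : ∀ i, CMDiffAt ∞ (T% (s i)) x) (hli : LinearIndependent ℝ fun i ↦ s i x) (i : Fin k) :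
    CMDiffAt ∞ (T% (fun y ↦ InnerProductSpace.gramSchmidt ℝ (fun j ↦ s j y) i)) x := by
  induction i using WellFoundedLT.induction with
  | ind i ih =>
    have h : T% (fun y ↦ InnerProductSpace.gramSchmidt ℝ (fun j ↦ s j y) i)
        = T% (s i - fun y ↦ ∑ j ∈ Finset.Iio i,
          (inner ℝ (InnerProductSpace.gramSchmidt ℝ (fun j ↦ s j y) j) (s i y)
            / inner ℝ (InnerProductSpace.gramSchmidt ℝ (fun j ↦ s j y) j)
                (InnerProductSpace.gramSchmidt ℝ (fun j ↦ s j y) j) : ℝ) •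
            InnerProductSpace.gramSchmidt ℝ (fun j ↦ s j y) j) := by
      funext y
      congr 1
      have := InnerProductSpace.gramSchmidt_def'' ℝ (fun j ↦ s j y) i
      simp only [real_inner_self_eq_norm_sq]
      exact eq_sub_of_add_eq this.symm
    rw [h]
    refine (hs i).sub_section (ContMDiffAt.sum_section fun j hj ↦ ?_)
    exact contMDiffAt_div_inner_self_smul (ih j (Finset.mem_Iio.mp hj))
      (contMDiffAt_inner (ih j (Finset.mem_Iio.mp hj)) (hs i))
      (InnerProductSpace.gramSchmidt_ne_zero j hli)

end SmoothSections

/-- Expansion of an orthogonal projection in an orthogonal frame. -/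
theorem starProjection_span_range_eq_sum {V ι : Type*} [NormedAddCommGroup V]
    [InnerProductSpace ℝ V] [Fintype ι] {e : ι → V} (he : Pairwise fun i j ↦ inner ℝ (e i) (e j) = 0)
    (h0 : ∀ i, e i ≠ 0) [(Submodule.span ℝ (Set.range e)).HasOrthogonalProjection] (v : V) :
    (Submodule.span ℝ (Set.range e)).starProjection v
      = ∑ i, (inner ℝ (e i) v / inner ℝ (e i) (e i)) • e i := by
  refine Submodule.eq_starProjection_of_mem_of_inner_eq_zero
    (Submodule.sum_mem _ fun i _ ↦ Submodule.smul_mem _ _ (Submodule.subset_span ⟨i, rfl⟩))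
    fun w hw ↦ ?_
  induction hw using Submodule.span_induction with
  | mem w hw =>
    obtain ⟨j, rfl⟩ := hw
    rw [inner_sub_left, sum_inner, Finset.sum_eq_single j]
    · have : inner ℝ (e j) (e j) ≠ 0 := by simpa using h0 j
      rw [real_inner_smul_left, real_inner_comm, div_mul_cancel₀ _ this, sub_self]
    · intro i _ hij
      simp [inner_smul_left, he hij]
    · simp
  | zero => simp
  | add a b _ _ ha hb => rw [inner_add_right, ha, hb, add_zero]
  | smul c a _ ha => rw [inner_smul_right, ha, mul_zero]

section Projection

variable {E : Type*} [NormedAddCommGroup E] [NormedSpace ℝ E] [FiniteDimensional ℝ E]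
  {H : Type*} [TopologicalSpace H] {I : ModelWithCorners ℝ E H}
  {M : Type*} [TopologicalSpace M] [ChartedSpace H M] [IsManifold I ∞ M]
  [RiemannianBundle (fun x : M ↦ TangentSpace I x)]
  [IsContMDiffRiemannianBundle I ∞ E (fun x : M ↦ TangentSpace I x)]

/-- The orthogonal projection of a vector field to the span of a smooth frame is smooth as soon as
the inner products of the vector field with smooth vector fields are smooth. -/
theorem contMDiffAt_starProjection_of_frame {D : Π y : M, Submodule ℝ (TangentSpace I y)} {k : ℕ}
    {s : Fin k → Π x : M, TangentSpace I x} {x : M} (hs : ∀ i, CMDiffAt ∞ (T% (s i)) x)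
    (hD : ∀ᶠ y in 𝓝 x, LinearIndependent ℝ (fun i ↦ s i y) ∧
      Submodule.span ℝ (Set.range fun i ↦ s i y) = D y)
    {T : Π y : M, TangentSpace I y}
    (hT : ∀ Z : Π y : M, TangentSpace I y, CMDiffAt ∞ (T% Z) x →
      CMDiffAt ∞ (fun y ↦ (inner ℝ (Z y) (T y) : ℝ)) x) :
    CMDiffAt ∞ (T% (fun y ↦ (D y).starProjection (T y))) x := by
  set e : Fin k → Π y : M, TangentSpace I y :=
    fun i y ↦ InnerProductSpace.gramSchmidt ℝ (fun j ↦ s j y) i with he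
  have hli := hD.self_of_nhds.1
  have hes (i) : CMDiffAt ∞ (T% (e i)) x := contMDiffAt_gramSchmidt hs hli i
  have hsum : CMDiffAt ∞ (T% (fun y ↦ ∑ i,
      ((inner ℝ (e i y) (T y) / inner ℝ (e i y) (e i y) : ℝ)) • e i y)) x :=
    ContMDiffAt.sum_section fun i _ ↦ contMDiffAt_div_inner_self_smul (hes i) (hT _ (hes i))
      (InnerProductSpace.gramSchmidt_ne_zero i hli)
  refine hsum.congr_of_eventuallyEq ?_
  filter_upwards [hD] with y hy
  have hspan : Submodule.span ℝ (Set.range fun i ↦ e i y) = D y := by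
    rw [← hy.2, he]; exact InnerProductSpace.span_gramSchmidt ℝ _
  rw [← starProjection_span_range_eq_sum
    (fun i j hij ↦ InnerProductSpace.gramSchmidt_orthogonal ℝ _ hij)
    (fun i ↦ InnerProductSpace.gramSchmidt_ne_zero i hy.1)]
  congr! 3
  exact hspan.symm

/-- A vector field is smooth if its inner products with smooth vector fields are. -/
theorem contMDiffAt_of_inner {T : Π y : M, TangentSpace I y} {x : M}
    (hT : ∀ Z : Π y : M, TangentSpace I y, CMDiffAt ∞ (T% Z) x →
      CMDiffAt ∞ (fun y ↦ (inner ℝ (Z y) (T y) : ℝ)) x) :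
    CMDiffAt ∞ (T% T) x := by
  let t := trivializationAt E (TangentSpace I) x
  let b := Module.finBasis ℝ E
  have hx : x ∈ t.baseSet := FiberBundle.mem_baseSet_trivializationAt' x
  have hframe := t.isLocalFrameOn_localFrame_baseSet I ∞ b
  have h := contMDiffAt_starProjection_of_frame (D := fun _ ↦ ⊤) (s := t.localFrame b)
    (fun i ↦ hframe.contMDiffAt t.open_baseSet hx i)
    (by
      filter_upwards [t.open_baseSet.mem_nhds hx] with y hy
      exact ⟨hframe.linearIndependent hy, top_le_iff.mp (hframe.generating hy)⟩) hT
  refine h.congr_of_eventuallyEq (.of_forall fun y ↦ ?_)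
  exact congrArg (TotalSpace.mk y) (Submodule.starProjection_eq_self_iff.mpr Submodule.mem_top).symm

end Projection

section Connection

variable {E : Type*} [NormedAddCommGroup E] [NormedSpace ℝ E] [FiniteDimensional ℝ E]
  {H : Type*} [TopologicalSpace H] {I : ModelWithCorners ℝ E H}
  {M : Type*} [TopologicalSpace M] [ChartedSpace H M] [IsManifold I ∞ M]
  [RiemannianBundle (fun x : M ↦ TangentSpace I x)]
  [IsContMDiffRiemannianBundle I ∞ E (fun x : M ↦ TangentSpace I x)]

theorem contMDiffAt_koszul {X Y Z : Π y : M, TangentSpace I y} {x : M}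
    (hY : CMDiffAt ∞ (T% Y) x) (hX : CMDiffAt ∞ (T% X) x) (hZ : CMDiffAt ∞ (T% Z) x) :
    CMDiffAt ∞ (koszul I Y X Z) x := by
  have : CompleteSpace E := FiniteDimensional.complete ℝ E
  unfold koszul
  refine contMDiffAt_const.mul ?_
  exact (((((contMDiffAt_mvfderiv_apply (contMDiffAt_inner hY hZ) hX).add
    (contMDiffAt_mvfderiv_apply (contMDiffAt_inner hX hZ) hY)).sub
    (contMDiffAt_mvfderiv_apply (contMDiffAt_inner hX hY) hZ)).add
    (contMDiffAt_inner (contMDiffAt_mlieBracket hX hY) hZ)).sub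
    (contMDiffAt_inner (contMDiffAt_mlieBracket hX hZ) hY)).sub
    (contMDiffAt_inner (contMDiffAt_mlieBracket hY hZ) hX)

theorem contMDiffAt_leviCivita {X Y : Π y : M, TangentSpace I y} {x : M}
    (hY : CMDiffAt ∞ (T% Y) x) (hX : CMDiffAt ∞ (T% X) x) :
    CMDiffAt ∞ (T% (fun y ↦ leviCivita I M Y y (X y))) x := by
  refine contMDiffAt_of_inner fun Z hZ ↦ (contMDiffAt_koszul hY hX hZ).congr_of_eventuallyEq ?_
  filter_upwards [eventually_mdifferentiableAt hY, eventually_mdifferentiableAt hX,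
    eventually_mdifferentiableAt hZ] with y hY hX hZ
  rw [real_inner_comm]
  exact inner_leviCivitaFun hY hX hZ

end Connection

end RiemannianGeometry

namespace RiemannianGeometry

section Distribution

variable {E : Type*} [NormedAddCommGroup E] [NormedSpace ℝ E]
  {H : Type*} [TopologicalSpace H] {I : ModelWithCorners ℝ E H}
  {N : Type*} [TopologicalSpace N] [ChartedSpace H N] [IsManifold I ∞ N]
  {D : Π y : N, Submodule ℝ (TangentSpace I y)} {O : Set N}

theorem IsSmoothSectionOn.contMDiffAt {V : Π y : N, TangentSpace I y}
    (hV : IsSmoothSectionOn D O V) (hO : IsOpen O) {y : N} (hy : y ∈ O) : CMDiffAt ∞ (T% V) y :=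
  (hV.1 y hy).contMDiffAt (hO.mem_nhds hy)

theorem IsSmoothSectionOn.mdifferentiableAt {V : Π y : N, TangentSpace I y}
    (hV : IsSmoothSectionOn D O V) (hO : IsOpen O) {y : N} (hy : y ∈ O) : MDiffAt (T% V) y :=
  (hV.contMDiffAt hO hy).mdifferentiableAt (by simp)

variable [FiniteDimensional ℝ E]

/-- Every tangent vector extends to a global smooth vector field. -/
theorem exists_contMDiff_vectorField [T2Space N] {y : N} (v : TangentSpace I y) :
    ∃ Z : Π y : N, TangentSpace I y, CMDiff ∞ (T% Z) ∧ Z y = v := by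
  obtain ⟨s, hs, hsv⟩ := FiberBundle.exists_contMDiffOn_extend (k := ∞) I E v
  obtain ⟨ψ, -, hψ⟩ := (SmoothBumpFunction.nhds_basis_tsupport (I := I) y).mem_iff.mp
    (interior_mem_nhds.mpr hs)
  refine ⟨(ψ : N → ℝ) • FiberBundle.extend E v, ContMDiffOn.smul_section_of_tsupport
    ψ.contMDiff.contMDiffOn isOpen_interior hψ (hsv.mono interior_subset), ?_⟩
  simp

variable [RiemannianBundle (fun y : N ↦ TangentSpace I y)]
  [IsContMDiffRiemannianBundle I ∞ E (fun y : N ↦ TangentSpace I y)]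

theorem contMDiffAt_starProjection (hD : IsSmoothDistributionOn D O) {y : N} (hy : y ∈ O)
    {T : Π y : N, TangentSpace I y} (hT : CMDiffAt ∞ (T% T) y) :
    CMDiffAt ∞ (T% (fun z ↦ (D z).starProjection (T z))) y := by
  obtain ⟨O', hO', k, s, hs, h⟩ := hD y hy
  exact contMDiffAt_starProjection_of_frame (fun i ↦ (hs i).contMDiffAt hO')
    (Filter.eventually_of_mem hO' h) fun Z hZ ↦ contMDiffAt_inner hZ hT

theorem isSmoothSectionOn_starProjection (hD : IsSmoothDistributionOn D O)
    {T : Π y : N, TangentSpace I y} (hT : ∀ y ∈ O, CMDiffAt ∞ (T% T) y) :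
    IsSmoothSectionOn D O (fun z ↦ (D z).starProjection (T z)) :=
  ⟨fun y hy ↦ (contMDiffAt_starProjection hD hy (hT y hy)).contMDiffWithinAt,
    fun _ _ ↦ Submodule.starProjection_apply_mem _ _⟩

set_option linter.unusedSectionVars false in
theorem starProjection_orthDistribution_apply (y : N) (v : TangentSpace I y) :
    (orthDistribution D y).starProjection v = v - (D y).starProjection v :=
  Submodule.starProjection_orthogonal_val v

theorem isSmoothSectionOn_starProjection_orth (hD : IsSmoothDistributionOn D O)
    {T : Π y : N, TangentSpace I y} (hT : ∀ y ∈ O, CMDiffAt ∞ (T% T) y) :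
    IsSmoothSectionOn (orthDistribution D) O
      (fun z ↦ (orthDistribution D z).starProjection (T z)) := by
  refine ⟨fun y hy ↦ ?_, fun _ _ ↦ Submodule.starProjection_apply_mem _ _⟩
  simp only [starProjection_orthDistribution_apply]
  exact ((hT y hy).sub_section (contMDiffAt_starProjection hD hy (hT y hy))).contMDiffWithinAt

theorem exists_section_orth [T2Space N] (hD : IsSmoothDistributionOn D O) {y : N}
    {v : TangentSpace I y} (hv : v ∈ orthDistribution D y) :
    ∃ Z : Π y : N, TangentSpace I y, IsSmoothSectionOn (orthDistribution D) O Z ∧ Z y = v := by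
  obtain ⟨Z, hZ, rfl⟩ := exists_contMDiff_vectorField v
  exact ⟨_, isSmoothSectionOn_starProjection_orth hD fun z _ ↦ hZ.contMDiffAt,
    Submodule.starProjection_eq_self_iff.mpr hv⟩

/-- Decomposition of `∇_a V` into its components in `D` and `D^⊥`. -/
theorem leviCivita_eq_sub_shape (V : Π y : N, TangentSpace I y) (y : N) (a : TangentSpace I y) :
    leviCivita I N V y a = normalConn D V y a - shape D V y a := by
  simp [normalConn, shape, starProjection_orthDistribution_apply]

theorem shape_mem (V : Π y : N, TangentSpace I y) (y : N) (a : TangentSpace I y) :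
    shape D V y a ∈ D y :=
  (D y).neg_mem (Submodule.starProjection_apply_mem _ _)

theorem normalConn_mem (V : Π y : N, TangentSpace I y) (y : N) (a : TangentSpace I y) :
    normalConn D V y a ∈ orthDistribution D y :=
  Submodule.starProjection_apply_mem _ _

theorem leviCivita_add {V W : Π y : N, TangentSpace I y} {y : N} (hV : MDiffAt (T% V) y)
    (hW : MDiffAt (T% W) y) :
    leviCivita I N (V + W) y = leviCivita I N V y + leviCivita I N W y :=
  (leviCivita I N).isCovariantDerivativeOnUniv.add hV hW

theorem leviCivita_congr {V W : Π y : N, TangentSpace I y} {y : N} (hV : MDiffAt (T% V) y)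
    (hW : MDiffAt (T% W) y) (h : ∀ᶠ z in 𝓝 y, V z = W z) :
    leviCivita I N V y = leviCivita I N W y :=
  (leviCivita I N).isCovariantDerivativeOnUniv.congr_of_eventuallyEq hV hW Filter.univ_mem h

theorem isSmoothSectionOn_shapeField (hD : IsSmoothDistributionOn D O)
    {V A : Π y : N, TangentSpace I y} (hV : ∀ y ∈ O, CMDiffAt ∞ (T% V) y)
    (hA : ∀ y ∈ O, CMDiffAt ∞ (T% A) y) : IsSmoothSectionOn D O (shapeField D V A) := by
  have h := isSmoothSectionOn_starProjection hD
    fun y hy ↦ contMDiffAt_leviCivita (hV y hy) (hA y hy)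
  exact ⟨h.1.neg_section, fun y hy ↦ shape_mem _ _ _⟩

theorem isSmoothSectionOn_normalConnField (hD : IsSmoothDistributionOn D O)
    {V A : Π y : N, TangentSpace I y} (hV : ∀ y ∈ O, CMDiffAt ∞ (T% V) y)
    (hA : ∀ y ∈ O, CMDiffAt ∞ (T% A) y) :
    IsSmoothSectionOn (orthDistribution D) O (normalConnField D A V) :=
  isSmoothSectionOn_starProjection_orth hD
    fun y hy ↦ contMDiffAt_leviCivita (hV y hy) (hA y hy)

section TotallyGeodesic

variable [T2Space N] (hO : IsOpen O) (hD : IsSmoothDistributionOn D O)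
  (hgeo : IsTotallyGeodesicOn (orthDistribution D) O)

include hD hgeo in
theorem leviCivita_mem_orth {V : Π y : N, TangentSpace I y}
    (hV : IsSmoothSectionOn (orthDistribution D) O V) {y : N} (hy : y ∈ O) {z : TangentSpace I y}
    (hz : z ∈ orthDistribution D y) : leviCivita I N V y z ∈ orthDistribution D y := by
  obtain ⟨Z, hZ, rfl⟩ := exists_section_orth hD hz
  exact hgeo Z V hZ hV y hy

include hD hgeo in
theorem leviCivita_eq_normalConn {V : Π y : N, TangentSpace I y}
    (hV : IsSmoothSectionOn (orthDistribution D) O V) {y : N} (hy : y ∈ O) {z : TangentSpace I y}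
    (hz : z ∈ orthDistribution D y) : leviCivita I N V y z = normalConn D V y z :=
  (Submodule.starProjection_eq_self_iff.mpr (leviCivita_mem_orth hD hgeo hV hy hz)).symm

include hO hD hgeo in
/-- If `D^⊥` is totally geodesic, then `∇` in directions of `D^⊥` preserves sections of `D`. -/
theorem leviCivita_mem_of_orth {A : Π y : N, TangentSpace I y} (hA : IsSmoothSectionOn D O A)
    {y : N} (hy : y ∈ O) {z : TangentSpace I y} (hz : z ∈ orthDistribution D y) :
    leviCivita I N A y z ∈ D y := by
  rw [← Submodule.orthogonal_orthogonal (D y), Submodule.mem_orthogonal]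
  intro w hw
  obtain ⟨Z, hZ, rfl⟩ := exists_section_orth hD hz
  obtain ⟨W, hW, rfl⟩ := exists_section_orth hD hw
  have h := leviCivita_metric (hZ.mdifferentiableAt hO hy) (hA.mdifferentiableAt hO hy)
    (hW.mdifferentiableAt hO hy)
  have h0 : (fun z : N ↦ (inner ℝ (A z) (W z) : ℝ)) =ᶠ[𝓝 y] fun _ ↦ 0 := by
    filter_upwards [hO.mem_nhds hy] with z hz
    exact (Submodule.mem_orthogonal _ _).mp (hW.2 z hz) _ (hA.2 z hz)
  have h1 : d% (fun z : N ↦ (inner ℝ (A z) (W z) : ℝ)) y (Z y) = 0 := by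
    rw [mvfderiv, h0.mfderiv_eq, mfderiv_const]
    rfl
  have h2 : (inner ℝ (A y) (leviCivita I N W y (Z y)) : ℝ) = 0 :=
    (Submodule.mem_orthogonal _ _).mp (hgeo Z W hZ hW y hy) _ (hA.2 y hy)
  rw [real_inner_comm]
  linarith

end TotallyGeodesic

section Curvature

variable (hO : IsOpen O) (hD : IsSmoothDistributionOn D O)
  (hgeo : IsTotallyGeodesicOn (orthDistribution D) O) {A V W : Π y : N, TangentSpace I y}
  (hA : IsSmoothSectionOn D O A) (hV : IsSmoothSectionOn (orthDistribution D) O V)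
  (hW : IsSmoothSectionOn (orthDistribution D) O W) {y : N} (hy : y ∈ O)

include hO hA hV hy in
theorem mlieBracket_eq_sub_shape :
    mlieBracket I A V y
      = normalConn D V y (A y) - shape D V y (A y) - leviCivita I N A y (V y) := by
  rw [← leviCivita_eq_sub_shape, leviCivita_torsion_free (hA.mdifferentiableAt hO hy)
    (hV.mdifferentiableAt hO hy)]

include hO hA hV hy in
theorem normalCurvature_eq_shape :
    normalCurvature D A V W y
      = normalConn D (normalConnField D V W) y (A y)
        - normalConn D (normalConnField D A W) y (V y)
        - normalConn D W y (normalConn D V y (A y))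
        + normalConn D W y (shape D V y (A y))
        + normalConn D W y (leviCivita I N A y (V y)) := by
  rw [normalCurvature, mlieBracket_eq_sub_shape hO hA hV hy, map_sub, map_sub]
  abel

variable [T2Space N]

include hO hD hgeo hA hV hW hy in
theorem riemannCurvature_eq_normalConn :
    riemannCurvature A V W y
      = leviCivita I N (normalConnField D V W) y (A y)
        + leviCivita I N (shapeField D W A) y (V y)
        - normalConn D (normalConnField D A W) y (V y)
        - leviCivita I N W y (mlieBracket I A V y) := by
  have hcA := fun z hz ↦ hA.contMDiffAt hO (y := z) hz
  have hcV := fun z hz ↦ hV.contMDiffAt hO (y := z) hz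
  have hcW := fun z hz ↦ hW.contMDiffAt hO (y := z) hz
  have hVW := isSmoothSectionOn_normalConnField hD hcW hcV
  have hAW := isSmoothSectionOn_normalConnField hD hcW hcA
  have hSW := isSmoothSectionOn_shapeField hD hcW hcA
  have hlc {B : Π y : N, TangentSpace I y} (hB : CMDiffAt ∞ (T% B) y) :
      MDiffAt (T% (fun z ↦ leviCivita I N W z (B z))) y :=
    (contMDiffAt_leviCivita (hcW y hy) hB).mdifferentiableAt (by simp)
  have h1 : leviCivita I N (fun z ↦ leviCivita I N W z (V z)) y
      = leviCivita I N (normalConnField D V W) y := by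
    refine leviCivita_congr (hlc (hcV y hy)) (hVW.mdifferentiableAt hO hy) ?_
    filter_upwards [hO.mem_nhds hy] with z hz
    exact leviCivita_eq_normalConn hD hgeo hW hz (hV.2 z hz)
  have h2 : normalConnField D A W
      = (fun z ↦ leviCivita I N W z (A z)) + shapeField D W A := by
    funext z
    simp [leviCivita_eq_sub_shape (D := D), normalConnField, shapeField]
  have h3 := leviCivita_eq_normalConn hD hgeo hAW hy (hV.2 y hy)
  rw [riemannCurvature, h1, ← h3, h2,
    leviCivita_add (hlc (hcA y hy)) (hSW.mdifferentiableAt hO hy)]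
  simp only [_root_.add_apply]
  abel

include hO hD hgeo hA hV hW hy in
/-- The decomposition of the curvature `R(A,V)W` for a section `A` of `D` and sections `V`, `W` of
the totally geodesic distribution `D^⊥`. -/
theorem riemannCurvature_eq_shape :
    riemannCurvature A V W y
      = - shape D (normalConnField D V W) y (A y)
        + normalConn D (normalConnField D V W) y (A y)
        + leviCivita I N (shapeField D W A) y (V y)
        - normalConn D (normalConnField D A W) y (V y)
        - shape D W y (shape D V y (A y))
        + normalConn D W y (shape D V y (A y))
        - normalConn D W y (normalConn D V y (A y))
        - shape D W y (leviCivita I N A y (V y))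
        + normalConn D W y (leviCivita I N A y (V y)) := by
  have h := leviCivita_eq_normalConn hD hgeo hW hy (normalConn_mem (D := D) V y (A y))
  rw [riemannCurvature_eq_normalConn hO hD hgeo hA hV hW hy,
    mlieBracket_eq_sub_shape hO hA hV hy, map_sub, map_sub, h,
    leviCivita_eq_sub_shape (D := D) (normalConnField D V W),
    leviCivita_eq_sub_shape (D := D) W y (shape D V y (A y)),
    leviCivita_eq_sub_shape (D := D) W y (leviCivita I N A y (V y))]
  abel

include hO hD hgeo hA hV hW hy in
theorem starProjection_riemannCurvature :
    (orthDistribution D y).starProjection (riemannCurvature A V W y)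
      = normalCurvature D A V W y := by
  have hS := leviCivita_mem_of_orth hO hD hgeo
    (isSmoothSectionOn_shapeField hD (fun z hz ↦ hW.contMDiffAt hO hz)
      fun z hz ↦ hA.contMDiffAt hO hz) hy (hV.2 y hy)
  rw [riemannCurvature_eq_normalConn hO hD hgeo hA hV hW hy, map_sub, map_sub, map_add,
    starProjection_orthDistribution_apply y (leviCivita I N (shapeField D W A) y (V y)),
    Submodule.starProjection_eq_self_iff.mpr hS,
    Submodule.starProjection_eq_self_iff.mpr (normalConn_mem (D := D) (normalConnField D A W) y _),
    sub_self, add_zero]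
  rfl

end Curvature

end Distribution

/-- A linear map which is isometric on the orthogonal complement of its kernel is a left inverse of
its adjoint on its range. -/
theorem apply_adjoint_of_isometric {V W : Type*} [NormedAddCommGroup V] [InnerProductSpace ℝ V]
    [FiniteDimensional ℝ V] [NormedAddCommGroup W] [InnerProductSpace ℝ W] [FiniteDimensional ℝ W]
    {L : V →ₗ[ℝ] W} (hL : ∀ u ∈ L.kerᗮ, ∀ v ∈ L.kerᗮ, inner ℝ (L u) (L v) = inner ℝ u v)
    {w : W} (hw : w ∈ L.range) : L (LinearMap.adjoint L w) = w := by
  have hproj (v : V) : L (L.kerᗮ.starProjection v) = L v := by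
    have : L (L.ker.starProjection v) = 0 := Submodule.starProjection_apply_mem L.ker v
    rw [Submodule.starProjection_orthogonal_val, map_sub, this, sub_zero]
  obtain ⟨v, rfl⟩ := hw
  have h : LinearMap.adjoint L (L v) = L.kerᗮ.starProjection v := by
    refine ext_inner_right ℝ fun x ↦ ?_
    rw [LinearMap.adjoint_inner_left, ← hproj v, ← hproj x,
      hL _ (Submodule.starProjection_apply_mem _ _) _ (Submodule.starProjection_apply_mem _ _),
      Submodule.inner_starProjection_left_eq_right, Submodule.inner_starProjection_left_eq_right,
      Submodule.starProjection_eq_self_iff.mpr (Submodule.starProjection_apply_mem _ _)]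
  rw [h, hproj]

end RiemannianGeometry

/-- `D` is the distribution `range F_*`, viewed as a distribution on the open set `O ⊆ N` that
restricts to the range of the differential of `F` along `U`. `V`, `W` are sections of `D^⊥`, and `A` is a
section of `D` that represents `F_* X` on `N` (only the value at `F p` has to agree). Dictionary:
`shape` is `S`; `normalConn`, `normalConnField`, `normalConnAlong` are `∇^{F⊥}` in the direction of
a tangent vector of `N`, a vector field on `N`, a tangent vector of `M`; `adjointDifferential` is
`*F_*`; `normalCurvature` is `R^{F⊥}`; `leviCivita (𝓡 n) N Y y v` is `∇^N_v Y` at `y`. -/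
theorem proposition3p1 {m n : ℕ}
    {M : Type*} [TopologicalSpace M] [T2Space M] [ChartedSpace (EuclideanSpace ℝ (Fin m)) M]
    [IsManifold (𝓡 m) ∞ M] [RiemannianBundle (fun x : M ↦ TangentSpace (𝓡 m) x)]
    [IsContMDiffRiemannianBundle (𝓡 m) ∞ (EuclideanSpace ℝ (Fin m))
      (fun x : M ↦ TangentSpace (𝓡 m) x)]
    {N : Type*} [TopologicalSpace N] [T2Space N] [ChartedSpace (EuclideanSpace ℝ (Fin n)) N]
    [IsManifold (𝓡 n) ∞ N] [RiemannianBundle (fun y : N ↦ TangentSpace (𝓡 n) y)]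
    [IsContMDiffRiemannianBundle (𝓡 n) ∞ (EuclideanSpace ℝ (Fin n))
      (fun y : N ↦ TangentSpace (𝓡 n) y)]
    (F : M → N) (hF : IsRiemannianMap (𝓡 m) (𝓡 n) F)
    (U : Set M) (hU : IsOpen U) (O : Set N) (hO : IsOpen O) (hUO : Set.MapsTo F U O)
    (D : Π y : N, Submodule ℝ (TangentSpace (𝓡 n) y))
    (hD : IsSmoothDistributionOn D O)
    (hDF : ∀ q ∈ U, D (F q) = (mfderiv (𝓡 m) (𝓡 n) F q).range)
    (hgeo : IsTotallyGeodesicOn (orthDistribution D) O)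
    (X : Π q : M, TangentSpace (𝓡 m) q) (A V W : Π y : N, TangentSpace (𝓡 n) y)
    (hA : IsSmoothSectionOn D O A)
    (hV : IsSmoothSectionOn (orthDistribution D) O V)
    (hW : IsSmoothSectionOn (orthDistribution D) O W)
    (p : M) (hp : p ∈ U) (hAX : A (F p) = mfderiv (𝓡 m) (𝓡 n) F p (X p)) :
    riemannCurvature A V W (F p) =
        - shape D (normalConnField D V W) (F p) (mfderiv (𝓡 m) (𝓡 n) F p (X p))
        + normalConnAlong (𝓡 m) F D (normalConnField D V W) p (X p)
        + leviCivita (𝓡 n) N (shapeField D W A) (F p) (V (F p))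
        - normalConn D (normalConnField D A W) (F p) (V (F p))
        - shape D W (F p) (shape D V (F p) (mfderiv (𝓡 m) (𝓡 n) F p (X p)))
        + normalConnAlong (𝓡 m) F D W p (adjointDifferential (𝓡 m) (𝓡 n) F p
            (shape D V (F p) (mfderiv (𝓡 m) (𝓡 n) F p (X p))))
        - normalConn D W (F p) (normalConnAlong (𝓡 m) F D V p (X p))
        - shape D W (F p) (leviCivita (𝓡 n) N A (F p) (V (F p)))
        + normalConnAlong (𝓡 m) F D W p (adjointDifferential (𝓡 m) (𝓡 n) F p
            (leviCivita (𝓡 n) N A (F p) (V (F p)))) ∧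
    (orthDistribution D (F p)).starProjection (riemannCurvature A V W (F p))
        = normalCurvature D A V W (F p) ∧
    normalCurvature D A V W (F p) =
        normalConnAlong (𝓡 m) F D (normalConnField D V W) p (X p)
        - normalConn D (normalConnField D A W) (F p) (V (F p))
        - normalConn D W (F p) (normalConnAlong (𝓡 m) F D V p (X p))
        + normalConnAlong (𝓡 m) F D W p (adjointDifferential (𝓡 m) (𝓡 n) F p
            (shape D V (F p) (mfderiv (𝓡 m) (𝓡 n) F p (X p))))
        + normalConnAlong (𝓡 m) F D W p (adjointDifferential (𝓡 m) (𝓡 n) F p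
            (leviCivita (𝓡 n) N A (F p) (V (F p)))) := by
  have hy : F p ∈ O := hUO hp
  have hadj {w : TangentSpace (𝓡 n) (F p)} (hw : w ∈ D (F p)) :
      normalConnAlong (𝓡 m) F D W p (adjointDifferential (𝓡 m) (𝓡 n) F p w)
        = normalConn D W (F p) w := by
    rw [hDF p hp] at hw
    exact congrArg (normalConn D W (F p))
      (apply_adjoint_of_isometric (L := (mfderiv (𝓡 m) (𝓡 n) F p).toLinearMap) (hF.2 p) hw)
  have halong (Z : Π y : N, TangentSpace (𝓡 n) y) :
      normalConnAlong (𝓡 m) F D Z p (X p) = normalConn D Z (F p) (A (F p)) := by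
    rw [hAX]; rfl
  rw [hadj (shape_mem _ _ _), hadj (leviCivita_mem_of_orth hO hD hgeo hA hy (hV.2 _ hy)),
    halong, halong, ← hAX]
  exact ⟨riemannCurvature_eq_shape hO hD hgeo hA hV hW hy,
    starProjection_riemannCurvature hO hD hgeo hA hV hW hy, normalCurvature_eq_shape hO hA hV hy⟩
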